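/- A (convex) polytope is the convex hull of a nonempty finite set of points in some $\mathbb R^d$; its dimension is the dimension of its affine hull, and its face lattice consists of the empty face and all subsets on which some linear functional attains its maximum over the polytope, ordered by inclusion. Two polytopes are combinatorially equivalent if there is an inclusion-preserving bijection (an isomorphism of ordered sets) between their face lattices; a combinatorial polytope is an equivalence class. The direct product $P\times Q\subset\mathbb R^m\times\mathbb R^n$ and the join $P\divideontimes Q$ (the convex hull of copies of $P\subset\mathbb R^m$ and $Q\subset\mathbb R^n$ placed in skew affine subspaces, e.g. $\operatorname{conv}\big(P\times\{0\}\times\{0\}\,\cup\,\{0\}\times Q\times\{1\}\big)\subset\mathbb R^m\times\mathbb R^n\times\mathbb R$) are well defined, commutative and associative on combinatorial polytopes, and the point is a unit for $\times$. Call a combinatorial polytope of positive dimension product-indecomposable if it is not a direct product of two polytopes of positive dimensions, and call a combinatorial polytope join-indecomposable if it is not the join of two (nonempty) polytopes. Let $(\mathcal P,\times)$ be the free abelian group on all combinatorial polytopes with multiplication extending $\times$ bilinearly, and let $\mathcal{RP}=(\mathcal P\oplus\mathbb Z\varnothing,\divideontimes)$ be the free abelian group on all combinatorial polytopes and one formal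 element $\varnothing$, with multiplication extending $\divideontimes$ bilinearly and with $\varnothing$ as unit. Proposition. 1. Every combinatorial polytope is the direct product of a unique finite multiset of product-indecomposable combinatorial polytopes (the empty multiset in the case of the point). 2. Every combinatorial polytope is the join of a unique finite multiset of join-indecomposable combinatorial polytopes. 3. $(\mathcal P,\times)$ is the polynomial ring on the product-indecomposable combinatorial polytopes: the ring homomorphism to $\mathcal P$ from the polynomial ring over $\mathbb Z$ with one variable for each such polytope, which sends each variable to its polytope, is bijective. 4. $\mathcal{RP}$ is, in the same sense, the polynomial ring over $\mathbb Z$ on the join-indecomposable combinatorial polytopes. -/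

import Mathlib

noncomputable section

/-! ### Convex polytopes and their face lattices -/

/-- A (nonempty) convex polytope: the convex hull of a nonempty finite set of points of
some `ℝ^d`. -/
structure Polytope where
  ambient : ℕ
  carrier : Set (Fin ambient → ℝ)
  nonempty : carrier.Nonempty
  exists_finite : ∃ s : Set (Fin ambient → ℝ), s.Finite ∧ carrier = convexHull ℝ s

/-- The faces of a set `A`, ordered by inclusion: the empty face, and the subsets of `A` on which
some linear functional attains its maximum over `A` (the zero functional gives `A` itself). -/
abbrev Faces {E : Type*} [TopologicalSpace E] [AddCommMonoid E] [Module ℝ E] (A : Set E) : Type _ :=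
  {F : Set E // IsExposed ℝ A F}

/-- The nonempty faces of a set, ordered by inclusion. -/
abbrev NonemptyFaces {E : Type*} [TopologicalSpace E] [AddCommMonoid E] [Module ℝ E] (A : Set E) :
    Type _ :=
  {F : Set E // IsExposed ℝ A F ∧ F.Nonempty}

section FaceLemmas

variable {E F V : Type*} [TopologicalSpace E] [AddCommGroup E] [Module ℝ E]
  [TopologicalSpace F] [AddCommGroup F] [Module ℝ F]
  [TopologicalSpace V] [AddCommGroup V] [Module ℝ V]

theorem isExposed_iff_affine {A X : Set E} :
    IsExposed ℝ A X ↔ ∃ (l : StrongDual ℝ E) (c : ℝ), (∀ a ∈ A, l a + c ≤ 0) ∧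
      X = {a ∈ A | l a + c = 0} := by
  constructor
  · intro h
    rcases X.eq_empty_or_nonempty with rfl | ⟨x, hx⟩
    · refine ⟨0, -1, by simp, ?_⟩
      ext; simp
    · obtain ⟨l, rfl⟩ := h ⟨x, hx⟩
      refine ⟨l, -l x, fun a ha => by linarith [hx.2 a ha], ?_⟩
      ext a
      constructor
      · rintro ⟨ha, h2⟩
        exact ⟨ha, by linarith [hx.2 a ha, h2 x hx.1]⟩
      · rintro ⟨ha, h2⟩
        exact ⟨ha, fun y hy => by linarith [hx.2 y hy]⟩
  · rintro ⟨l, c, hle, rfl⟩ ⟨x, hx⟩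
    refine ⟨l, ?_⟩
    ext a
    constructor
    · rintro ⟨ha, h2⟩
      exact ⟨ha, fun y hy => by linarith [hle y hy]⟩
    · rintro ⟨ha, h2⟩
      exact ⟨ha, by linarith [hle a ha, h2 x hx.1, hx.2]⟩

/-- The empty face together with the nonempty faces gives all the faces. -/
def facesEquivWithBot (A : Set E) : WithBot (NonemptyFaces A) ≃o Faces A :=
  RelIso.ofSurjective (r := (· ≤ ·)) (s := (· ≤ ·))
    (OrderEmbedding.ofMapLEIff
      (fun X : WithBot (NonemptyFaces A) => match X with
        | none => (⟨∅, isExposed_empty⟩ : Faces A)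
        | some G => ⟨G.1, G.2.1⟩)
      (by
        intro X Y
        induction X using WithBot.recBotCoe with
        | bot => exact ⟨fun _ => bot_le, fun _ => Set.empty_subset _⟩
        | coe X =>
          induction Y using WithBot.recBotCoe with
          | bot =>
            obtain ⟨x, hx⟩ := X.2.2
            exact ⟨fun h => absurd (h hx) (Set.notMem_empty x),
              fun h => absurd (WithBot.le_bot_iff.1 h) WithBot.coe_ne_bot⟩
          | coe Y => exact (WithBot.coe_le_coe (a := X) (b := Y)).symm))
    (by
      rintro ⟨X, hX⟩
      rcases X.eq_empty_or_nonempty with rfl | hne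
      · exact ⟨⊥, rfl⟩
      · exact ⟨((⟨X, hX, hne⟩ : NonemptyFaces A) : WithBot (NonemptyFaces A)), rfl⟩)

theorem faces_map_empty {A : Set E} {B : Set F} (e : Faces A ≃o Faces B) (X : Faces A) :
    (e X).1 = ∅ ↔ X.1 = ∅ := by
  constructor
  · intro h
    have h1 : e X ≤ e ⟨∅, isExposed_empty⟩ := by
      rw [← Subtype.coe_le_coe, h]; exact Set.empty_subset _
    exact Set.subset_empty_iff.1 (e.le_iff_le.1 h1)
  · intro h
    have h1 : X ≤ e.symm ⟨∅, isExposed_empty⟩ := by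
      rw [← Subtype.coe_le_coe, h]; exact Set.empty_subset _
    have h2 := e.monotone h1
    rw [OrderIso.apply_symm_apply] at h2
    exact Set.subset_empty_iff.1 h2

theorem nonempty_faces_iso_iff {A : Set E} {B : Set F} :
    Nonempty (Faces A ≃o Faces B) ↔ Nonempty (NonemptyFaces A ≃o NonemptyFaces B) := by
  constructor
  · rintro ⟨e⟩
    have key : ∀ {X : Faces A}, X.1.Nonempty → (e X).1.Nonempty := by
      intro X h
      rw [Set.nonempty_iff_ne_empty] at h ⊢
      exact fun h2 => h ((faces_map_empty e X).1 h2)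
    have key2 : ∀ {X : Faces B}, X.1.Nonempty → (e.symm X).1.Nonempty := by
      intro X h
      rw [Set.nonempty_iff_ne_empty] at h ⊢
      exact fun h2 => h ((faces_map_empty e.symm X).1 h2)
    refine ⟨⟨⟨fun X => ⟨(e ⟨X.1, X.2.1⟩).1, (e ⟨X.1, X.2.1⟩).2, key X.2.2⟩,
      fun X => ⟨(e.symm ⟨X.1, X.2.1⟩).1, (e.symm ⟨X.1, X.2.1⟩).2, key2 X.2.2⟩, ?_, ?_⟩, ?_⟩⟩
    · intro X; simp
    · intro X; simp
    · intro X Y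
      exact e.le_iff_le (x := ⟨X.1, X.2.1⟩) (y := ⟨Y.1, Y.2.1⟩)
  · rintro ⟨e⟩
    exact ⟨((facesEquivWithBot A).symm.trans e.withBotCongr).trans (facesEquivWithBot B)⟩

/-- The faces of a set correspond to the faces of its image under a linear isomorphism. -/
def nonemptyFacesImage (e : E ≃L[ℝ] F) (A : Set E) :
    NonemptyFaces A ≃o NonemptyFaces (e '' A) :=
  RelIso.ofSurjective (r := (· ≤ ·)) (s := (· ≤ ·))
    (OrderEmbedding.ofMapLEIff
      (fun X : NonemptyFaces A => (⟨e '' X.1, by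
        refine ⟨?_, X.2.2.image _⟩
        obtain ⟨l, c, hle, hX⟩ := isExposed_iff_affine.1 X.2.1
        refine isExposed_iff_affine.2 ⟨l.comp (e.symm : F →L[ℝ] E), c, ?_, ?_⟩
        · rintro _ ⟨a, ha, rfl⟩
          simpa using hle a ha
        · rw [hX]
          ext y
          constructor
          · rintro ⟨a, ⟨ha, h0⟩, rfl⟩
            exact ⟨⟨a, ha, rfl⟩, by simpa using h0⟩
          · rintro ⟨⟨a, ha, rfl⟩, h0⟩
            exact ⟨a, ⟨ha, by simpa using h0⟩, rfl⟩⟩ : NonemptyFaces (e '' A)))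
      (by
        intro X Y
        exact Set.image_subset_image_iff e.injective))
    (by
      rintro ⟨Y, hY, hne⟩
      obtain ⟨l, c, hle, hX⟩ := isExposed_iff_affine.1 hY
      have hYA : Y ⊆ e '' A := hY.subset
      have him : e '' (e ⁻¹' Y) = Y := Set.image_preimage_eq _ e.surjective
      refine ⟨⟨e ⁻¹' Y, ?_, ?_⟩, Subtype.ext him⟩
      · refine isExposed_iff_affine.2 ⟨l.comp (e : E →L[ℝ] F), c, ?_, ?_⟩
        · intro a ha
          exact hle _ ⟨a, ha, rfl⟩
        · ext a
          constructor
          · intro ha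
            obtain ⟨b, hb, hba⟩ := hYA ha
            have hb2 := e.injective hba
            subst hb2
            have h2 : e b ∈ {a ∈ e '' A | l a + c = 0} := hX ▸ ha
            exact ⟨hb, h2.2⟩
          · rintro ⟨ha, h0⟩
            show e a ∈ Y
            rw [hX]
            exact ⟨⟨a, ha, rfl⟩, h0⟩
      · obtain ⟨y, hy⟩ := hne
        exact ⟨e.symm y, by simpa using hy⟩)

/-- The nonempty faces of a direct product are the products of nonempty faces. -/
def nonemptyFacesProd (A : Set E) (B : Set F) :
    NonemptyFaces A × NonemptyFaces B ≃o NonemptyFaces (A ×ˢ B) :=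
  RelIso.ofSurjective (r := (· ≤ ·)) (s := (· ≤ ·))
    (OrderEmbedding.ofMapLEIff
      (fun X : NonemptyFaces A × NonemptyFaces B => (⟨X.1.1 ×ˢ X.2.1, by
        refine ⟨?_, X.1.2.2.prod X.2.2.2⟩
        obtain ⟨l, c, hle, hX⟩ := isExposed_iff_affine.1 X.1.2.1
        obtain ⟨k, d, hke, hY⟩ := isExposed_iff_affine.1 X.2.2.1
        refine isExposed_iff_affine.2
          ⟨l.comp (ContinuousLinearMap.fst ℝ E F) + k.comp (ContinuousLinearMap.snd ℝ E F),
            c + d, ?_, ?_⟩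
        · rintro ⟨a, b⟩ ⟨ha, hb⟩
          have h1 := hle a ha
          have h2 := hke b hb
          simp only [add_apply, ContinuousLinearMap.comp_apply,
            ContinuousLinearMap.coe_fst', ContinuousLinearMap.coe_snd']
          linarith
        · rw [hX, hY]
          ext ⟨a, b⟩
          simp only [add_apply, ContinuousLinearMap.comp_apply,
            ContinuousLinearMap.coe_fst', ContinuousLinearMap.coe_snd', Set.mem_prod,
            Set.mem_ofPred_eq]
          constructor
          · rintro ⟨⟨ha, h1⟩, hb, h2⟩
            exact ⟨⟨ha, hb⟩, by linarith⟩
          · rintro ⟨⟨ha, hb⟩, h0⟩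
            have h1 := hle a ha
            have h2 := hke b hb
            exact ⟨⟨ha, by linarith⟩, hb, by linarith⟩⟩ : NonemptyFaces (A ×ˢ B)))
      (by
        rintro ⟨X, Y⟩ ⟨X', Y'⟩
        show X.1 ×ˢ Y.1 ⊆ X'.1 ×ˢ Y'.1 ↔ _
        constructor
        · intro h
          obtain ⟨x, hx⟩ := X.2.2
          obtain ⟨y, hy⟩ := Y.2.2
          exact ⟨fun a ha => (h (Set.mk_mem_prod ha hy)).1,
            fun b hb => (h (Set.mk_mem_prod hx hb)).2⟩
        · rintro ⟨h1, h2⟩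
          exact Set.prod_mono h1 h2))
    (by
      rintro ⟨Z, hZ, hne⟩
      obtain ⟨l, c, hle, hX⟩ := isExposed_iff_affine.1 hZ
      obtain ⟨⟨a₀, b₀⟩, h₀⟩ := hne
      have hl : ∀ a b, l (a, b) = l (a, 0) + l (0, b) := by
        intro a b; rw [← map_add]; simp
      have h₁ : (a₀, b₀) ∈ {a ∈ A ×ˢ B | l a + c = 0} := hX ▸ h₀
      obtain ⟨⟨ha₀, hb₀⟩, h₂⟩ := h₁
      simp only at ha₀ hb₀
      rw [hl] at h₂
      have e1 : ∀ a ∈ A, l (a, 0) ≤ l (a₀, 0) := by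
        intro a ha
        have := hle (a, b₀) ⟨ha, hb₀⟩
        rw [hl] at this
        linarith
      have e2 : ∀ b ∈ B, l (0, b) ≤ l (0, b₀) := by
        intro b hb
        have := hle (a₀, b) ⟨ha₀, hb⟩
        rw [hl] at this
        linarith
      refine ⟨⟨⟨{a ∈ A | l (a, 0) + -l (a₀, 0) = 0}, ?_, a₀, ha₀, by simp⟩,
        ⟨{b ∈ B | l (0, b) + -l (0, b₀) = 0}, ?_, b₀, hb₀, by simp⟩⟩, Subtype.ext ?_⟩
      · exact isExposed_iff_affine.2 ⟨l.comp (ContinuousLinearMap.inl ℝ E F), -l (a₀, 0),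
          fun a ha => by simpa using e1 a ha, by ext; simp⟩
      · exact isExposed_iff_affine.2 ⟨l.comp (ContinuousLinearMap.inr ℝ E F), -l (0, b₀),
          fun b hb => by simpa using e2 b hb, by ext; simp⟩
      · show {a ∈ A | l (a, 0) + -l (a₀, 0) = 0} ×ˢ {b ∈ B | l (0, b) + -l (0, b₀) = 0} = Z
        rw [hX]
        ext ⟨a, b⟩
        simp only [Set.mem_prod, Set.mem_ofPred_eq]
        rw [hl a b]
        constructor
        · rintro ⟨⟨ha, h1⟩, hb, h2⟩
          exact ⟨⟨ha, hb⟩, by linarith⟩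
        · rintro ⟨⟨ha, hb⟩, h0⟩
          have h1 := e1 a ha
          have h2 := e2 b hb
          exact ⟨⟨ha, by linarith⟩, hb, by linarith⟩)

/-- The faces of the convex hull of two polytopes placed in skew affine subspaces (through maps
`i`, `j` such that affine functionals pull back and every pair of them extends) are pairs of
possibly empty faces. -/
def facesJoin (A : Set E) (B : Set F) (i : E → V) (j : F → V) (C : Set V)
    (hi : ∀ l : StrongDual ℝ V, ∃ (k : StrongDual ℝ E) (d : ℝ), ∀ a, l (i a) = k a + d)
    (hj : ∀ l : StrongDual ℝ V, ∃ (k : StrongDual ℝ F) (d : ℝ), ∀ b, l (j b) = k b + d)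
    (hext : ∀ (k₁ : StrongDual ℝ E) (d₁ : ℝ) (k₂ : StrongDual ℝ F) (d₂ : ℝ),
      ∃ (l : StrongDual ℝ V) (c : ℝ), (∀ a, l (i a) + c = k₁ a + d₁) ∧
        ∀ b, l (j b) + c = k₂ b + d₂)
    (hiC : ∀ a ∈ A, i a ∈ C) (hjC : ∀ b ∈ B, j b ∈ C)
    (hC : ∀ x ∈ C, ∃ a ∈ A, ∃ b ∈ B, ∃ s t : ℝ, 0 ≤ s ∧ 0 ≤ t ∧ s + t = 1 ∧
      x = s • i a + t • j b) :
    Faces C ≃o Faces A × Faces B :=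
  RelIso.ofSurjective (r := (· ≤ ·)) (s := (· ≤ ·))
    (OrderEmbedding.ofMapLEIff
      (fun X : Faces C => ((⟨{a ∈ A | i a ∈ X.1}, by
        obtain ⟨l, c, hle, hX⟩ := isExposed_iff_affine.1 X.2
        obtain ⟨k, d, hk⟩ := hi l
        refine isExposed_iff_affine.2 ⟨k, d + c, fun a ha => ?_, ?_⟩
        · have := hle _ (hiC a ha)
          rw [hk] at this
          linarith
        · rw [hX]
          ext a
          simp only [Set.mem_ofPred_eq, hk, add_assoc]
          exact ⟨fun h => ⟨h.1, h.2.2⟩, fun h => ⟨h.1, hiC a h.1, h.2⟩⟩⟩,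
        ⟨{b ∈ B | j b ∈ X.1}, by
        obtain ⟨l, c, hle, hX⟩ := isExposed_iff_affine.1 X.2
        obtain ⟨k, d, hk⟩ := hj l
        refine isExposed_iff_affine.2 ⟨k, d + c, fun a ha => ?_, ?_⟩
        · have := hle _ (hjC a ha)
          rw [hk] at this
          linarith
        · rw [hX]
          ext a
          simp only [Set.mem_ofPred_eq, hk, add_assoc]
          exact ⟨fun h => ⟨h.1, h.2.2⟩, fun h => ⟨h.1, hjC a h.1, h.2⟩⟩⟩) : Faces A × Faces B))
      (by
        intro X Y
        constructor
        · rintro ⟨h1, h2⟩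
          obtain ⟨l, c, hle, hX⟩ := isExposed_iff_affine.1 X.2
          obtain ⟨k, d, hke, hY⟩ := isExposed_iff_affine.1 Y.2
          intro x hx
          have hx2 : x ∈ {a ∈ C | l a + c = 0} := hX ▸ hx
          obtain ⟨hxC, hx0⟩ := hx2
          obtain ⟨a, ha, b, hb, s, t, hs, ht, hst, rfl⟩ := hC x hxC
          have la := hle _ (hiC a ha)
          have lb := hle _ (hjC b hb)
          simp only [map_add, map_smul, smul_eq_mul] at hx0
          have e0 : s * (l (i a) + c) + t * (l (j b) + c) = 0 := by
            linear_combination hx0 + c * hst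
          have p1 : s * (l (i a) + c) ≤ 0 := mul_nonpos_of_nonneg_of_nonpos hs la
          have p2 : t * (l (j b) + c) ≤ 0 := mul_nonpos_of_nonneg_of_nonpos ht lb
          have q1 : s * (k (i a) + d) = 0 := by
            rcases mul_eq_zero.1 (show s * (l (i a) + c) = 0 by linarith) with h | h
            · simp [h]
            · have m1 : i a ∈ X.1 := by rw [hX]; exact ⟨hiC a ha, h⟩
              have m2 : i a ∈ Y.1 := (h1 (show a ∈ {a ∈ A | i a ∈ X.1} from ⟨ha, m1⟩)).2
              rw [hY] at m2
              rw [m2.2, mul_zero]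
          have q2 : t * (k (j b) + d) = 0 := by
            rcases mul_eq_zero.1 (show t * (l (j b) + c) = 0 by linarith) with h | h
            · simp [h]
            · have m1 : j b ∈ X.1 := by rw [hX]; exact ⟨hjC b hb, h⟩
              have m2 : j b ∈ Y.1 := (h2 (show b ∈ {b ∈ B | j b ∈ X.1} from ⟨hb, m1⟩)).2
              rw [hY] at m2
              rw [m2.2, mul_zero]
          show s • i a + t • j b ∈ Y.1
          rw [hY]
          refine ⟨hxC, ?_⟩
          simp only [map_add, map_smul, smul_eq_mul]
          linear_combination q1 + q2 - d * hst
        · intro h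
          exact ⟨fun a ha => ⟨ha.1, h ha.2⟩, fun b hb => ⟨hb.1, h hb.2⟩⟩))
    (by
      rintro ⟨⟨X, hX⟩, ⟨Y, hY⟩⟩
      obtain ⟨k₁, d₁, h₁, hX⟩ := isExposed_iff_affine.1 hX
      obtain ⟨k₂, d₂, h₂, hY⟩ := isExposed_iff_affine.1 hY
      obtain ⟨l, c, hl₁, hl₂⟩ := hext k₁ d₁ k₂ d₂
      refine ⟨⟨{x ∈ C | l x + c = 0}, isExposed_iff_affine.2 ⟨l, c, ?_, rfl⟩⟩, ?_⟩
      · intro x hx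
        obtain ⟨a, ha, b, hb, s, t, hs, ht, hst, rfl⟩ := hC x hx
        have p1 := mul_nonpos_of_nonneg_of_nonpos hs (h₁ a ha)
        have p2 := mul_nonpos_of_nonneg_of_nonpos ht (h₂ b hb)
        rw [← hl₁] at p1
        rw [← hl₂] at p2
        simp only [map_add, map_smul, smul_eq_mul]
        have : s * l (i a) + t * l (j b) + c = s * (l (i a) + c) + t * (l (j b) + c) := by
          linear_combination - c * hst
        linarith
      · refine Prod.ext (Subtype.ext ?_) (Subtype.ext ?_)
        · show {a ∈ A | i a ∈ {x ∈ C | l x + c = 0}} = X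
          rw [hX]
          ext a
          simp only [Set.mem_ofPred_eq, hl₁]
          exact ⟨fun h => ⟨h.1, h.2.2⟩, fun h => ⟨h.1, hiC a h.1, h.2⟩⟩
        · show {b ∈ B | j b ∈ {x ∈ C | l x + c = 0}} = Y
          rw [hY]
          ext b
          simp only [Set.mem_ofPred_eq, hl₂]
          exact ⟨fun h => ⟨h.1, h.2.2⟩, fun h => ⟨h.1, hjC b h.1, h.2⟩⟩)

end FaceLemmas

/-- Products of order isomorphisms. -/
def orderIsoProdCongr {α β γ δ : Type*} [PartialOrder α] [PartialOrder β] [PartialOrder γ]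
    [PartialOrder δ] (e : α ≃o β) (f : γ ≃o δ) : α × γ ≃o β × δ where
  toEquiv := e.toEquiv.prodCongr f.toEquiv
  map_rel_iff' := and_congr e.le_iff_le f.le_iff_le

/-- The identification `ℝ^m × ℝ^n ≃ ℝ^(m+n)` by concatenation of coordinates. -/
def appendL (m n : ℕ) : ((Fin m → ℝ) × (Fin n → ℝ)) ≃ₗ[ℝ] (Fin (m + n) → ℝ) where
  toFun p := Fin.append p.1 p.2
  invFun x := (fun i => x (Fin.castAdd n i), fun j => x (Fin.natAdd m j))
  map_add' p q := by
    funext i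
    refine Fin.addCases (fun i => ?_) (fun i => ?_) i <;> simp
  map_smul' c p := by
    funext i
    refine Fin.addCases (fun i => ?_) (fun i => ?_) i <;> simp
  left_inv p := by simp
  right_inv x := by
    funext i
    refine Fin.addCases (fun i => ?_) (fun i => ?_) i <;> simp

namespace Polytope

/-- The face lattice `L(P)` of a polytope, including the faces `∅` and `P`. -/
abbrev FaceLattice (P : Polytope) : Type := Faces P.carrier

/-- Two polytopes are combinatorially equivalent if there is an inclusion preserving bijection
between their face lattices. -/
def CombEquiv (P Q : Polytope) : Prop := Nonempty (P.FaceLattice ≃o Q.FaceLattice)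

/-- The dimension of a polytope: the dimension of its affine hull. -/
def dim (P : Polytope) : ℕ := Module.finrank ℝ (vectorSpan ℝ P.carrier)

theorem convex (P : Polytope) : Convex ℝ P.carrier := by
  obtain ⟨s, -, h⟩ := P.exists_finite
  rw [h]
  exact convex_convexHull ℝ s

theorem isCompact (P : Polytope) : IsCompact P.carrier := by
  obtain ⟨s, hs, h⟩ := P.exists_finite
  rw [h]
  exact hs.isCompact_convexHull ℝ

/-- The point. -/
def point : Polytope where
  ambient := 0
  carrier := {0}
  nonempty := Set.singleton_nonempty 0
  exists_finite := ⟨{0}, Set.finite_singleton 0, (convexHull_singleton 0).symm⟩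

/-- The direct product `P × Q ⊂ ℝ^m × ℝ^n` of polytopes `P ⊂ ℝ^m` and `Q ⊂ ℝ^n`. -/
def prod (P Q : Polytope) : Polytope where
  ambient := P.ambient + Q.ambient
  carrier := appendL P.ambient Q.ambient '' (P.carrier ×ˢ Q.carrier)
  nonempty := (P.nonempty.prod Q.nonempty).image _
  exists_finite := by
    obtain ⟨s, hs, h⟩ := P.exists_finite
    obtain ⟨t, ht, h2⟩ := Q.exists_finite
    refine ⟨appendL P.ambient Q.ambient '' (s ×ˢ t), (hs.prod ht).image _, ?_⟩
    rw [h, h2, ← convexHull_prod]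
    exact LinearMap.image_convexHull (appendL P.ambient Q.ambient).toLinearMap _

/-- The embedding `x ↦ (x, 0, 0)` of `ℝ^m` into `ℝ^m × ℝ^n × ℝ`. -/
def joinInl (m n : ℕ) (x : Fin m → ℝ) : Fin (m + n + 1) → ℝ :=
  appendL (m + n) 1 (appendL m n (x, 0), 0)

/-- The embedding `y ↦ (0, y, 1)` of `ℝ^n` into `ℝ^m × ℝ^n × ℝ`. The image and that of `joinInl`
are skew affine subspaces. -/
def joinInr (m n : ℕ) (y : Fin n → ℝ) : Fin (m + n + 1) → ℝ :=
  appendL (m + n) 1 (appendL m n (0, y), 1)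

/-- `joinInl` as an affine map. -/
def joinInlA (m n : ℕ) : (Fin m → ℝ) →ᵃ[ℝ] (Fin (m + n + 1) → ℝ) :=
  ((appendL (m + n) 1).toLinearMap ∘ₗ
    LinearMap.inl ℝ _ _ ∘ₗ (appendL m n).toLinearMap ∘ₗ LinearMap.inl ℝ _ _).toAffineMap

/-- `joinInr` as an affine map. -/
def joinInrA (m n : ℕ) : (Fin n → ℝ) →ᵃ[ℝ] (Fin (m + n + 1) → ℝ) :=
  ((appendL (m + n) 1).toLinearMap ∘ₗ
    LinearMap.inl ℝ _ _ ∘ₗ (appendL m n).toLinearMap ∘ₗ LinearMap.inr ℝ _ _).toAffineMap +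
  AffineMap.const ℝ _ (appendL (m + n) 1 (0, 1))

theorem joinInlA_apply (m n : ℕ) (x) : joinInlA m n x = joinInl m n x := rfl

theorem joinInrA_apply (m n : ℕ) (y) : joinInrA m n y = joinInr m n y := by
  simp [joinInrA, joinInr, ← map_add]

/-- The join of `P ⊂ ℝ^m` and `Q ⊂ ℝ^n`: the convex hull of `P` and `Q` placed in skew affine
subspaces of `ℝ^m × ℝ^n × ℝ`. -/
def join (P Q : Polytope) : Polytope where
  ambient := P.ambient + Q.ambient + 1
  carrier := convexHull ℝ
    (joinInl P.ambient Q.ambient '' P.carrier ∪ joinInr P.ambient Q.ambient '' Q.carrier)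
  nonempty := by
    rw [convexHull_nonempty_iff]
    exact (P.nonempty.image _).inl
  exists_finite := by
    obtain ⟨s, hs, h⟩ := P.exists_finite
    obtain ⟨t, ht, h2⟩ := Q.exists_finite
    refine ⟨joinInl P.ambient Q.ambient '' s ∪ joinInr P.ambient Q.ambient '' t,
      (hs.image _).union (ht.image _), ?_⟩
    have e1 : joinInl P.ambient Q.ambient = joinInlA P.ambient Q.ambient :=
      funext fun x => (joinInlA_apply _ _ x).symm
    have e2 : joinInr P.ambient Q.ambient = joinInrA P.ambient Q.ambient :=
      funext fun x => (joinInrA_apply _ _ x).symm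
    rw [h, h2, e1, e2, AffineMap.image_convexHull, AffineMap.image_convexHull,
      convexHull_convexHull_union_left, convexHull_convexHull_union_right]

/-- The nonempty faces of `P × Q` are the products of nonempty faces. -/
def nonemptyFacesProdIso (P Q : Polytope) :
    NonemptyFaces P.carrier × NonemptyFaces Q.carrier ≃o NonemptyFaces (P.prod Q).carrier :=
  (nonemptyFacesProd P.carrier Q.carrier).trans
    (nonemptyFacesImage (appendL P.ambient Q.ambient).toContinuousLinearEquiv
      (P.carrier ×ˢ Q.carrier))

theorem exists_dual_comp {m n : ℕ} (i : (Fin m → ℝ) →ᵃ[ℝ] (Fin n → ℝ))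
    (l : StrongDual ℝ (Fin n → ℝ)) :
    ∃ (k : StrongDual ℝ (Fin m → ℝ)) (d : ℝ), ∀ a, l (i a) = k a + d := by
  refine ⟨LinearMap.toContinuousLinearMap (l.toLinearMap ∘ₗ i.linear), l (i 0), fun a => ?_⟩
  have : i a = i.linear a + i 0 := by
    have := i.map_vadd 0 a
    simpa using this
  rw [this, map_add]
  rfl

/-- The faces of the join `P ⋇ Q` correspond to pairs of possibly empty faces of `P` and `Q`. -/
def faceLatticeJoin (P Q : Polytope) :
    (P.join Q).FaceLattice ≃o P.FaceLattice × Q.FaceLattice :=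
  facesJoin P.carrier Q.carrier (joinInl P.ambient Q.ambient) (joinInr P.ambient Q.ambient) _
    (exists_dual_comp (joinInlA P.ambient Q.ambient))
    (fun l => by
      obtain ⟨k, d, h⟩ := exists_dual_comp (joinInrA P.ambient Q.ambient) l
      exact ⟨k, d, fun b => by rw [← h, joinInrA_apply]⟩)
    (fun k₁ d₁ k₂ d₂ => by
      refine ⟨LinearMap.toContinuousLinearMap
        ((((k₁.toLinearMap ∘ₗ LinearMap.fst ℝ _ _ + k₂.toLinearMap ∘ₗ LinearMap.snd ℝ _ _) ∘ₗ
            (appendL P.ambient Q.ambient).symm.toLinearMap) ∘ₗ LinearMap.fst ℝ _ _ +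
          (d₂ - d₁) • (LinearMap.proj (0 : Fin 1)) ∘ₗ LinearMap.snd ℝ _ _) ∘ₗ
          (appendL (P.ambient + Q.ambient) 1).symm.toLinearMap), d₁, fun a => ?_, fun b => ?_⟩
      · simp [joinInl]
      · simp [joinInr]
        ring)
    (fun a ha => subset_convexHull ℝ _ (Or.inl ⟨a, ha, rfl⟩))
    (fun b hb => subset_convexHull ℝ _ (Or.inr ⟨b, hb, rfl⟩))
    (fun x hx => by
      have e1 : joinInl P.ambient Q.ambient = joinInlA P.ambient Q.ambient :=
        funext fun x => (joinInlA_apply _ _ x).symm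
      have e2 : joinInr P.ambient Q.ambient = joinInrA P.ambient Q.ambient :=
        funext fun x => (joinInrA_apply _ _ x).symm
      have c1 : Convex ℝ (joinInl P.ambient Q.ambient '' P.carrier) := by
        rw [e1]; exact P.convex.affine_image _
      have c2 : Convex ℝ (joinInr P.ambient Q.ambient '' Q.carrier) := by
        rw [e2]; exact Q.convex.affine_image _
      change x ∈ convexHull ℝ _ at hx
      rw [convexHull_union (P.nonempty.image _) (Q.nonempty.image _), c1.convexHull_eq,
        c2.convexHull_eq, mem_convexJoin] at hx
      obtain ⟨_, ⟨a, ha, rfl⟩, _, ⟨b, hb, rfl⟩, s, t, hs, ht, hst, rfl⟩ := hx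
      exact ⟨a, ha, b, hb, s, t, hs, ht, hst, rfl⟩)

theorem CombEquiv.symm {P Q : Polytope} : P.CombEquiv Q → Q.CombEquiv P := fun ⟨e⟩ => ⟨e.symm⟩

theorem CombEquiv.trans {P Q R : Polytope} : P.CombEquiv Q → Q.CombEquiv R → P.CombEquiv R :=
  fun ⟨e⟩ ⟨f⟩ => ⟨e.trans f⟩

theorem combEquiv_iff {P Q : Polytope} :
    P.CombEquiv Q ↔ Nonempty (NonemptyFaces P.carrier ≃o NonemptyFaces Q.carrier) :=
  nonempty_faces_iso_iff

/-- Combinatorial equivalence as an equivalence relation. -/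
instance setoid : Setoid Polytope where
  r := CombEquiv
  iseqv := ⟨fun _ => ⟨OrderIso.refl _⟩, CombEquiv.symm, CombEquiv.trans⟩

theorem prod_congr {P P' Q Q' : Polytope} (h : P.CombEquiv P') (h' : Q.CombEquiv Q') :
    (P.prod Q).CombEquiv (P'.prod Q') := by
  obtain ⟨e⟩ := combEquiv_iff.1 h
  obtain ⟨e'⟩ := combEquiv_iff.1 h'
  exact combEquiv_iff.2 ⟨(nonemptyFacesProdIso P Q).symm.trans
    ((orderIsoProdCongr e e').trans (nonemptyFacesProdIso P' Q'))⟩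

theorem prod_comm (P Q : Polytope) : (P.prod Q).CombEquiv (Q.prod P) :=
  combEquiv_iff.2 ⟨(nonemptyFacesProdIso P Q).symm.trans
    (OrderIso.prodComm.trans (nonemptyFacesProdIso Q P))⟩

theorem prod_assoc (P Q R : Polytope) :
    ((P.prod Q).prod R).CombEquiv (P.prod (Q.prod R)) :=
  combEquiv_iff.2 ⟨(nonemptyFacesProdIso (P.prod Q) R).symm.trans
    ((orderIsoProdCongr (nonemptyFacesProdIso P Q).symm (OrderIso.refl _)).trans
    ((OrderIso.prodAssoc _ _ _).trans
    ((orderIsoProdCongr (OrderIso.refl _) (nonemptyFacesProdIso Q R)).trans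
      (nonemptyFacesProdIso P (Q.prod R)))))⟩

theorem subsingleton_nonemptyFaces {P : Polytope} (h : P.carrier.Subsingleton) :
    Subsingleton (NonemptyFaces P.carrier) := by
  have key : ∀ X : NonemptyFaces P.carrier, X.1 = P.carrier := by
    intro X
    obtain ⟨x, hx⟩ := X.2.2
    refine Set.Subset.antisymm X.2.1.subset fun y hy => ?_
    rw [h hy (X.2.1.subset hx)]
    exact hx
  exact ⟨fun X Y => Subtype.ext ((key X).trans (key Y).symm)⟩

theorem prod_point (P : Polytope) : (P.prod point).CombEquiv P := by
  have : Subsingleton (NonemptyFaces point.carrier) :=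
    subsingleton_nonemptyFaces Set.subsingleton_singleton
  let p : NonemptyFaces point.carrier := ⟨point.carrier, IsExposed.refl _, point.nonempty⟩
  refine combEquiv_iff.2 ⟨(nonemptyFacesProdIso P point).symm.trans
    ⟨⟨fun X => X.1, fun X => (X, p), fun X => Prod.ext rfl (Subsingleton.elim _ _),
      fun X => rfl⟩, ?_⟩⟩
  rintro ⟨X, X'⟩ ⟨Y, Y'⟩
  exact ⟨fun h => ⟨h, (Subsingleton.elim X' Y').le⟩, fun h => h.1⟩

theorem join_congr {P P' Q Q' : Polytope} (h : P.CombEquiv P') (h' : Q.CombEquiv Q') :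
    (P.join Q).CombEquiv (P'.join Q') := by
  obtain ⟨e⟩ := h
  obtain ⟨e'⟩ := h'
  exact ⟨(faceLatticeJoin P Q).trans ((orderIsoProdCongr e e').trans (faceLatticeJoin P' Q').symm)⟩

theorem join_comm (P Q : Polytope) : (P.join Q).CombEquiv (Q.join P) :=
  ⟨(faceLatticeJoin P Q).trans (OrderIso.prodComm.trans (faceLatticeJoin Q P).symm)⟩

theorem join_assoc (P Q R : Polytope) :
    ((P.join Q).join R).CombEquiv (P.join (Q.join R)) :=
  ⟨(faceLatticeJoin (P.join Q) R).trans
    ((orderIsoProdCongr (faceLatticeJoin P Q) (OrderIso.refl _)).trans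
    ((OrderIso.prodAssoc _ _ _).trans
    ((orderIsoProdCongr (OrderIso.refl _) (faceLatticeJoin Q R).symm).trans
      (faceLatticeJoin P (Q.join R)).symm)))⟩

theorem dim_eq_zero_iff (P : Polytope) :
    P.dim = 0 ↔ Subsingleton (NonemptyFaces P.carrier) := by
  rw [dim, Submodule.finrank_eq_zero, vectorSpan_eq_bot_iff_subsingleton]
  refine ⟨subsingleton_nonemptyFaces, fun hs x hx y hy => ?_⟩
  funext i
  let l : StrongDual ℝ (Fin P.ambient → ℝ) := ContinuousLinearMap.proj i
  obtain ⟨z, hz, hmax⟩ := P.isCompact.exists_isMaxOn P.nonempty l.continuous.continuousOn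
  have hz2 : z ∈ l.toExposed P.carrier := ⟨hz, fun w hw => hmax hw⟩
  have h1 : (⟨l.toExposed P.carrier, ContinuousLinearMap.toExposed.isExposed, z, hz2⟩ :
      NonemptyFaces P.carrier) = ⟨P.carrier, IsExposed.refl _, P.nonempty⟩ :=
    Subsingleton.elim _ _
  have h2 : l.toExposed P.carrier = P.carrier := congrArg Subtype.val h1
  have hx2 : x ∈ l.toExposed P.carrier := by rw [h2]; exact hx
  have hy2 : y ∈ l.toExposed P.carrier := by rw [h2]; exact hy
  exact le_antisymm (hy2.2 x hx) (hx2.2 y hy)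

theorem CombEquiv.dim_pos {P Q : Polytope} (h : P.CombEquiv Q) (hP : 0 < P.dim) : 0 < Q.dim := by
  obtain ⟨e⟩ := combEquiv_iff.1 h
  rw [Nat.pos_iff_ne_zero, Ne, dim_eq_zero_iff] at hP ⊢
  exact fun hQ => hP e.toEquiv.subsingleton

/-- A polytope of positive dimension is product-indecomposable if it is not combinatorially
equivalent to a direct product of two polytopes of positive dimensions. -/
def IsProdIndecomposable (P : Polytope) : Prop :=
  0 < P.dim ∧ ¬ ∃ P₁ P₂ : Polytope, 0 < P₁.dim ∧ 0 < P₂.dim ∧ P.CombEquiv (P₁.prod P₂)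

/-- A polytope is join-indecomposable if it is not combinatorially equivalent to the join of two
(nonempty) polytopes. -/
def IsJoinIndecomposable (P : Polytope) : Prop :=
  ¬ ∃ P₁ P₂ : Polytope, P.CombEquiv (P₁.join P₂)

theorem CombEquiv.isProdIndecomposable {P Q : Polytope} (h : P.CombEquiv Q)
    (hP : P.IsProdIndecomposable) : Q.IsProdIndecomposable :=
  ⟨h.dim_pos hP.1, fun ⟨P₁, P₂, h₁, h₂, e⟩ => hP.2 ⟨P₁, P₂, h₁, h₂, h.trans e⟩⟩

theorem CombEquiv.isJoinIndecomposable {P Q : Polytope} (h : P.CombEquiv Q)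
    (hP : P.IsJoinIndecomposable) : Q.IsJoinIndecomposable :=
  fun ⟨P₁, P₂, e⟩ => hP ⟨P₁, P₂, h.trans e⟩

end Polytope

/-! ### Combinatorial polytopes and the two rings -/

/-- A combinatorial polytope: a class of combinatorially equivalent polytopes. As a type with
multiplication, it carries the direct product. -/
def CombPolytope : Type := Quotient Polytope.setoid

/-- Combinatorial polytopes again; as a type with multiplication, it carries the join. -/
def JoinCombPolytope : Type := Quotient Polytope.setoid

/-- Combinatorial polytopes under direct product, with the point as unit. -/
instance CombPolytope.commMonoid : CommMonoid CombPolytope where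
  mul := Quotient.map₂ Polytope.prod fun _ _ h _ _ h' => Polytope.prod_congr h h'
  one := Quotient.mk _ Polytope.point
  mul_assoc := by
    rintro ⟨P⟩ ⟨Q⟩ ⟨R⟩
    exact Quotient.sound (P.prod_assoc Q R)
  mul_comm := by
    rintro ⟨P⟩ ⟨Q⟩
    exact Quotient.sound (P.prod_comm Q)
  mul_one := by
    rintro ⟨P⟩
    exact Quotient.sound P.prod_point
  one_mul := by
    rintro ⟨P⟩
    exact Quotient.sound ((Polytope.prod_comm _ _).trans P.prod_point)

/-- Combinatorial polytopes under join (without a unit). -/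
instance JoinCombPolytope.commSemigroup : CommSemigroup JoinCombPolytope where
  mul := Quotient.map₂ Polytope.join fun _ _ h _ _ h' => Polytope.join_congr h h'
  mul_assoc := by
    rintro ⟨P⟩ ⟨Q⟩ ⟨R⟩
    exact Quotient.sound (P.join_assoc Q R)
  mul_comm := by
    rintro ⟨P⟩ ⟨Q⟩
    exact Quotient.sound (P.join_comm Q)

/-- Product-indecomposable combinatorial polytopes. -/
def CombPolytope.IsIndecomposable : CombPolytope → Prop :=
  Quotient.lift Polytope.IsProdIndecomposable fun _ _ h =>
    propext ⟨Polytope.CombEquiv.isProdIndecomposable h,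
      Polytope.CombEquiv.isProdIndecomposable (Polytope.CombEquiv.symm h)⟩

/-- Join-indecomposable combinatorial polytopes. -/
def JoinCombPolytope.IsIndecomposable : JoinCombPolytope → Prop :=
  Quotient.lift Polytope.IsJoinIndecomposable fun _ _ h =>
    propext ⟨Polytope.CombEquiv.isJoinIndecomposable h,
      Polytope.CombEquiv.isJoinIndecomposable (Polytope.CombEquiv.symm h)⟩

/-- The ring `(𝒫, ×)`: the free abelian group on combinatorial polytopes, with multiplication
extending the direct product bilinearly. -/
abbrev PolytopeRing : Type := MonoidAlgebra ℤ CombPolytope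

/-- The ring `ℛ𝒫 = (𝒫 ⊕ ℤ∅, ⋇)`: the free abelian group on combinatorial polytopes and a formal
unit `∅`, with multiplication extending the join bilinearly. -/
abbrev JoinPolytopeRing : Type := MonoidAlgebra ℤ (WithOne JoinCombPolytope)

end

/-! Both operations become direct products of finite posets with a greatest element. The nonempty
faces of `P × Q` are the pairs of nonempty faces, and the faces of the join are the pairs of
possibly empty faces. The formal unit of the join corresponds to the one-element poset, the faces of
the empty set. Each poset determines the combinatorial class, so unique factorization can be proved
for posets.

The heart is `OrderIso.exists_refinement`. Given `A × B ≃o C × D`, identify `A` with `A × {⊤}`,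
which is an upper set. If `a` corresponds to `(c, d)`, it is the meet of the elements corresponding
to `(c, ⊤)` and `(⊤, d)`. These lie above `a`, hence again in `A`. So `A` splits into its common
parts with `C` and with `D`, and likewise for the other factors. No least element is needed, which
matters because the poset of nonempty faces usually has none.

The pieces of a refinement must again come from polytopes. A factor `X` of a finite `X × Y` is the
lower set of `(⊤, b)` with `b` minimal, and a lower set of a face poset is the face poset of a face.
Hence the monoid of classes has refinement. In such a monoid with trivial units irreducibles can be
cancelled and behave like primes, which gives uniqueness. Existence is induction on the number of
faces, which is multiplicative (`existsUnique_multiset_of_posets`).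

Unique factorization says that the monoid is free commutative on its irreducibles, and the monoid
algebra of a free commutative monoid is a polynomial ring (`MonoidAlgebra.bijective_aeval_of`). -/

/-! ### Common refinements of direct decompositions of posets with a greatest element -/

section PosetRefinement

variable {A B C D : Type*} [PartialOrder A] [PartialOrder B] [PartialOrder C] [PartialOrder D]
  [OrderTop B] [OrderTop D]

/-- The common part of the factors `A` and `C` in two decompositions `A × B ≃o C × D`. -/
abbrev OrderIso.Corner (f : A × B ≃o C × D) : Type _ := {a : A // (f (a, ⊤)).2 = ⊤}

instance OrderIso.cornerOrderTop [OrderTop A] [OrderTop C] (f : A × B ≃o C × D) :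
    OrderTop f.Corner :=
  Subtype.orderTop (by
    change (f ⊤).2 = ⊤
    rw [map_top]
    rfl)

/-- `A × {⊤}` is an upper set, and `f.symm (c, ⊤)` lies above `(a, ⊤)`. -/
theorem OrderIso.symm_mk_top_snd (f : A × B ≃o C × D) {a : A} {c : C} (h : (f (a, ⊤)).1 ≤ c) :
    (f.symm (c, ⊤)).2 = ⊤ := by
  have : (a, ⊤) ≤ f.symm (c, ⊤) := f.le_symm_apply.2 ⟨h, le_top⟩
  exact top_le_iff.1 this.2

theorem OrderIso.apply_corner (f : A × B ≃o C × D) (a : f.Corner) :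
    f (a.1, ⊤) = ((f (a.1, ⊤)).1, ⊤) := Prod.ext rfl a.2

/-- The common part of two factors does not depend on which decomposition comes first. -/
def OrderIso.cornerSymm (f : A × B ≃o C × D) : f.Corner ≃o f.symm.Corner where
  toFun a := ⟨(f (a.1, ⊤)).1, by rw [← f.apply_corner, f.symm_apply_apply]⟩
  invFun c := ⟨(f.symm (c.1, ⊤)).1, by
    have := f.symm.apply_corner c
    rw [← this, f.apply_symm_apply]⟩
  left_inv a := Subtype.ext (by simp only [← f.apply_corner, f.symm_apply_apply])
  right_inv c := Subtype.ext (by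
    have := f.symm.apply_corner c
    simp only [← this, f.apply_symm_apply])
  map_rel_iff' := by
    intro a a'
    have h : f (a.1, ⊤) ≤ f (a'.1, ⊤) ↔ (a.1, (⊤ : B)) ≤ (a'.1, ⊤) := f.le_iff_le
    rw [f.apply_corner, f.apply_corner, Prod.mk_le_mk, Prod.mk_le_mk] at h
    exact Iff.trans ⟨fun h => ⟨h, a'.2.ge⟩, fun h => h.1⟩ (h.trans ⟨fun h => h.1, fun h => ⟨h, le_rfl⟩⟩)

variable [OrderTop C]

/-- In two decompositions `A × B ≃o C × D`, the factor `A` is the product of its common parts with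
`C` and with `D`. -/
theorem OrderIso.nonempty_corner_prod (f : A × B ≃o C × D) :
    Nonempty (f.Corner × (f.trans OrderIso.prodComm).Corner ≃o A) := by
  have hs (a : A) : f.symm ((f (a, ⊤)).1, ⊤) = ((f.symm ((f (a, ⊤)).1, ⊤)).1, ⊤) :=
    Prod.ext rfl (f.symm_mk_top_snd le_rfl)
  have ht (a : A) : f.symm (⊤, (f (a, ⊤)).2) = ((f.symm (⊤, (f (a, ⊤)).2)).1, ⊤) :=
    Prod.ext rfl ((f.trans OrderIso.prodComm).symm_mk_top_snd le_rfl)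
  -- The map sends `a`, with `f (a, ⊤) = (c, d)`, to the preimages of `(c, ⊤)` and `(⊤, d)`; its
  -- inverse takes meets.
  refine ⟨(RelIso.ofSurjective (r := (· ≤ ·)) (s := (· ≤ ·)) (OrderEmbedding.ofMapLEIff
    (fun a : A => ((⟨(f.symm ((f (a, ⊤)).1, ⊤)).1, ?_⟩ : f.Corner),
      (⟨(f.symm (⊤, (f (a, ⊤)).2)).1, ?_⟩ : (f.trans OrderIso.prodComm).Corner))) ?_) ?_).symm⟩
  · rw [← hs, f.apply_symm_apply]
  · show (f _).1 = ⊤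
    rw [← ht, f.apply_symm_apply]
  · intro a a'
    have h : f (a, ⊤) ≤ f (a', ⊤) ↔ (a, (⊤ : B)) ≤ (a', ⊤) := f.le_iff_le
    have h₁ := f.symm.le_iff_le (x := ((f (a, ⊤)).1, ⊤)) (y := ((f (a', ⊤)).1, ⊤))
    have h₂ := f.symm.le_iff_le (x := (⊤, (f (a, ⊤)).2)) (y := (⊤, (f (a', ⊤)).2))
    rw [hs a, hs a'] at h₁
    rw [ht a, ht a'] at h₂
    simp only [Prod.mk_le_mk, le_refl, and_true, true_and] at h h₁ h₂
    exact (and_congr h₁ h₂).trans h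
  · rintro ⟨⟨a, ha⟩, ⟨b, hb⟩⟩
    replace hb : (f (b, ⊤)).1 = ⊤ := hb
    -- Meets in `A` are not given, but `(c, ⊤)` and `(⊤, d)` do have the meet `(c, d)` in `C × D`;
    -- `w` is its preimage.
    set w := f.symm ((f (a, ⊤)).1, (f (b, ⊤)).2) with hw
    have hfw : f w = ((f (a, ⊤)).1, (f (b, ⊤)).2) := f.apply_symm_apply _
    have ea : f (a, ⊤) = ((f (a, ⊤)).1, ⊤) := Prod.ext rfl ha
    have eb : f (b, ⊤) = (⊤, (f (b, ⊤)).2) := Prod.ext hb rfl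
    have wa : w ≤ (a, ⊤) := by
      rw [← f.le_iff_le, hfw, ea]; exact ⟨le_rfl, le_top⟩
    have wb : w ≤ (b, ⊤) := by
      rw [← f.le_iff_le, hfw, eb]; exact ⟨le_top, le_rfl⟩
    -- Raising the second coordinate of `w` to `⊤` keeps it below `(a, ⊤)` and `(b, ⊤)`, hence below
    -- their meet `w`. So that coordinate was already `⊤`.
    have pa : f (w.1, ⊤) ≤ f (a, ⊤) := f.monotone ⟨wa.1, le_rfl⟩
    have pb : f (w.1, ⊤) ≤ f (b, ⊤) := f.monotone ⟨wb.1, le_rfl⟩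
    have pw : (w.1, ⊤) ≤ w := by
      rw [← f.le_iff_le, hfw]; exact ⟨pa.1, pb.2⟩
    have hwe : w = (w.1, ⊤) := Prod.ext rfl (top_le_iff.1 pw.2)
    refine ⟨w.1, Prod.ext (Subtype.ext ?_) (Subtype.ext ?_)⟩
    · show (f.symm ((f (w.1, ⊤)).1, ⊤)).1 = a
      rw [← hwe, hfw]
      show (f.symm ((f (a, ⊤)).1, ⊤)).1 = a
      rw [← ea, f.symm_apply_apply]
    · show (f.symm (⊤, (f (w.1, ⊤)).2)).1 = b
      rw [← hwe, hfw]
      show (f.symm (⊤, (f (b, ⊤)).2)).1 = b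
      rw [← eb, f.symm_apply_apply]

variable [OrderTop A]

/-- Two direct decompositions of a poset with a greatest element have a common refinement. -/
theorem OrderIso.exists_refinement (f : A × B ≃o C × D) :
    ∃ (g : A × B ≃o D × C) (h : B × A ≃o C × D) (k : B × A ≃o D × C),
      Nonempty (f.Corner × g.Corner ≃o A) ∧ Nonempty (h.Corner × k.Corner ≃o B) ∧
      Nonempty (f.Corner × h.Corner ≃o C) ∧ Nonempty (g.Corner × k.Corner ≃o D) := by
  refine ⟨f.trans OrderIso.prodComm, OrderIso.prodComm.trans f,
    OrderIso.prodComm.trans (f.trans OrderIso.prodComm), f.nonempty_corner_prod,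
    (OrderIso.prodComm.trans f).nonempty_corner_prod, ?_, ?_⟩
  -- The inverse isomorphism splits `C`, and `cornerSymm` identifies its corners with those of `f`
  -- and `h`.
  · obtain ⟨e⟩ := f.symm.nonempty_corner_prod
    exact ⟨(orderIsoProdCongr f.cornerSymm (OrderIso.prodComm.trans f).cornerSymm).trans e⟩
  · obtain ⟨e⟩ := (f.trans OrderIso.prodComm).symm.nonempty_corner_prod
    exact ⟨(orderIsoProdCongr (f.trans OrderIso.prodComm).cornerSymm
      (OrderIso.prodComm.trans (f.trans OrderIso.prodComm)).cornerSymm).trans e⟩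

end PosetRefinement

/-- The lower sets of elements that correspond under an order isomorphism are isomorphic. -/
def OrderIso.iicCongr {A B : Type*} [PartialOrder A] [PartialOrder B] (e : A ≃o B) (a : A) :
    Set.Iic a ≃o Set.Iic (e a) where
  toEquiv := e.toEquiv.subtypeEquiv fun _ => e.le_iff_le.symm
  map_rel_iff' := e.le_iff_le

/-- The first factor of a product is the lower set of `(⊤, b)`, for `b` minimal. -/
def iicProdOfIsMin {A B : Type*} [PartialOrder A] [OrderTop A] [PartialOrder B] {b : B}
    (hb : IsMin b) : Set.Iic ((⊤ : A), b) ≃o A where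
  toFun x := x.1.1
  invFun a := ⟨(a, b), le_top, le_rfl⟩
  left_inv x := Subtype.ext (Prod.ext rfl (hb.eq_of_le x.2.2).symm)
  right_inv _ := rfl
  map_rel_iff' := by
    rintro ⟨⟨a, x⟩, h⟩ ⟨⟨a', x'⟩, h'⟩
    obtain rfl : x = b := hb.eq_of_le h.2
    obtain rfl : x' = x := hb.eq_of_le h'.2
    exact ⟨fun h => ⟨h, le_rfl⟩, fun h => h.1⟩

/-! ### Unique factorization in refinement monoids -/

/-- Any two factorizations of an element into two factors have a common refinement. -/
def HasRefinement (M : Type*) [Mul M] : Prop :=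
  ∀ a b c d : M, a * b = c * d → ∃ x y z w, a = x * y ∧ b = z * w ∧ c = x * z ∧ d = y * w

section RefinementMonoid

variable {M : Type*} [CommMonoid M] [Subsingleton Mˣ]

/-- Refine `p * b = p * c` to `p = x * y = x * z`, `b = z * w`, `c = y * w`. Irreducibility leaves
`x = 1`, so `y = z = p`, or `y = z = 1`; either way `b = c`. -/
theorem HasRefinement.cancel (hM : HasRefinement M) {p b c : M} (hp : Irreducible p)
    (h : p * b = p * c) : b = c := by
  obtain ⟨x, y, z, w, e₁, rfl, e₂, rfl⟩ := hM p b p c h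
  rcases hp.isUnit_or_isUnit e₁ with hx | hy
  · rw [isUnit_iff_eq_one.1 hx, one_mul] at e₁ e₂
    rw [← e₁, ← e₂]
  · rw [isUnit_iff_eq_one.1 hy, mul_one] at e₁
    subst e₁
    rcases hp.isUnit_or_isUnit e₂ with hx | hz
    · exact absurd hx hp.not_isUnit
    · rw [isUnit_iff_eq_one.1 hy, isUnit_iff_eq_one.1 hz]

/-- Irreducibles act as primes: in a refinement of `p * b = c * t.prod`, the irreducible `p` goes
entirely into `c`, and then equals it, or entirely into `t.prod`. -/
theorem HasRefinement.mem_of_mul_eq_prod (hM : HasRefinement M) {p : M} (hp : Irreducible p)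
    (t : Multiset M) : ∀ b, (∀ q ∈ t, Irreducible q) → p * b = t.prod → p ∈ t := by
  induction t using Multiset.induction_on with
  | empty =>
    intro b _ h
    exact absurd (IsUnit.of_mul_eq_one _ h) hp.not_isUnit
  | cons c t ih =>
    intro b ht h
    rw [Multiset.prod_cons] at h
    obtain ⟨x, y, z, w, e₁, -, e₂, e₃⟩ := hM _ _ _ _ h
    have hc : Irreducible c := ht c (Multiset.mem_cons_self _ _)
    rcases hp.isUnit_or_isUnit e₁ with hx | hy
    · rw [isUnit_iff_eq_one.1 hx, one_mul] at e₁
      subst e₁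
      exact Multiset.mem_cons_of_mem
        (ih w (fun q hq => ht q (Multiset.mem_cons_of_mem hq)) e₃.symm)
    · rw [isUnit_iff_eq_one.1 hy, mul_one] at e₁
      subst e₁
      rcases hc.isUnit_or_isUnit e₂ with hx | hz
      · exact absurd hx hp.not_isUnit
      · rw [isUnit_iff_eq_one.1 hz, mul_one] at e₂
        rw [e₂]
        exact Multiset.mem_cons_self _ _

theorem HasRefinement.multiset_eq_of_prod_eq (hM : HasRefinement M) (s : Multiset M) :
    ∀ t : Multiset M, (∀ q ∈ s, Irreducible q) → (∀ q ∈ t, Irreducible q) → s.prod = t.prod →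
      s = t := by
  induction s using Multiset.induction_on with
  | empty =>
    intro t _ ht h
    refine (Multiset.eq_zero_of_forall_notMem fun q hq => (ht q hq).not_isUnit ?_).symm
    exact isUnit_of_dvd_one (by rw [← Multiset.prod_zero, h]; exact Multiset.dvd_prod hq)
  | cons p s ih =>
    intro t hs ht h
    have hp : Irreducible p := hs p (Multiset.mem_cons_self _ _)
    rw [Multiset.prod_cons] at h
    obtain ⟨t, rfl⟩ := Multiset.exists_cons_of_mem (hM.mem_of_mul_eq_prod hp t _ ht h)
    rw [Multiset.prod_cons] at h
    rw [ih t (fun q hq => hs q (Multiset.mem_cons_of_mem hq))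
      (fun q hq => ht q (Multiset.mem_cons_of_mem hq)) (hM.cancel hp h)]

/-- In a factorization into two nonunits both sizes exceed 1, so both factors are strictly smaller.
-/
theorem exists_multiset_irreducible_prod_eq (size : M → ℕ) (hpos : ∀ a, 0 < size a)
    (hone : ∀ a, size a = 1 → a = 1) (hmul : ∀ a b, size (a * b) = size a * size b) (a : M) :
    ∃ s : Multiset M, (∀ q ∈ s, Irreducible q) ∧ s.prod = a := by
  induction h : size a using Nat.strong_induction_on generalizing a with
  | _ n ih =>
    subst h
    by_cases ha : Irreducible a
    · exact ⟨{a}, by simpa using ha, by simp⟩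
    by_cases h1 : a = 1
    · exact ⟨0, by simp, by simp [h1]⟩
    rw [irreducible_iff, not_and_or, not_not, isUnit_iff_eq_one] at ha
    rcases ha with ha | ha
    · exact absurd ha h1
    push Not at ha
    obtain ⟨b, c, rfl, hb, hc⟩ := ha
    have hb1 : 1 < size b := lt_of_le_of_ne (hpos b) fun e => hb (by simp [hone b e.symm])
    have hc1 : 1 < size c := lt_of_le_of_ne (hpos c) fun e => hc (by simp [hone c e.symm])
    obtain ⟨s, hs, rfl⟩ := ih (size b) (by rw [hmul]; exact lt_mul_of_one_lt_right (hpos _) hc1) b rfl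
    obtain ⟨t, ht, rfl⟩ := ih (size c) (by rw [hmul]; exact lt_mul_of_one_lt_left (hpos _) hb1) c rfl
    refine ⟨s + t, fun q hq => ?_, by simp⟩
    rcases Multiset.mem_add.1 hq with hq | hq
    exacts [hs q hq, ht q hq]

end RefinementMonoid

/-- A commutative monoid whose elements `m` are represented by finite posets `T m` with a greatest
element, so that multiplication is the direct product and all lower sets `Set.Iic x` of such posets
are represented, has unique factorization into irreducible elements. -/
theorem existsUnique_multiset_of_posets {M : Type*} [CommMonoid M] (T : M → Type*)
    [∀ m, PartialOrder (T m)] [∀ m, OrderTop (T m)] [∀ m, Finite (T m)]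
    (hmul : ∀ m n, Nonempty (T (m * n) ≃o T m × T n))
    (hinj : ∀ m n, Nonempty (T m ≃o T n) → m = n)
    (hIic : ∀ m (x : T m), ∃ n, Nonempty (T n ≃o Set.Iic x)) :
    Subsingleton Mˣ ∧ ∀ m, ∃! s : Multiset M, (∀ q ∈ s, Irreducible q) ∧ s.prod = m := by
  have hpos (m) : 0 < Nat.card (T m) := Nat.card_pos
  have hcard (m n) : Nat.card (T (m * n)) = Nat.card (T m) * Nat.card (T n) := by
    obtain ⟨e⟩ := hmul m n
    rw [Nat.card_congr e.toEquiv, Nat.card_prod]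
  -- The size of `T 1` is a positive idempotent.
  have hcard1 : Nat.card (T 1) = 1 := by
    have := hcard 1 1
    rw [mul_one] at this
    exact (Nat.eq_of_mul_eq_mul_left (hpos 1) (by rw [mul_one]; exact this)).symm
  have hone (m) (h : Nat.card (T m) = 1) : m = 1 := by
    have h1 := (Nat.card_eq_one_iff_unique.1 h).1
    have h2 := (Nat.card_eq_one_iff_unique.1 hcard1).1
    exact hinj m 1 ⟨⟨⟨fun _ => ⊤, fun _ => ⊤, fun _ => Subsingleton.elim _ _,
      fun _ => Subsingleton.elim _ _⟩, fun {x y} => by simp [Subsingleton.elim x y]⟩⟩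
  have hunits : Subsingleton Mˣ := by
    refine subsingleton_of_forall_eq 1 fun u => Units.ext (hone _ ?_)
    have h := hcard u (u⁻¹ : Mˣ)
    rw [Units.mul_inv, hcard1] at h
    exact Nat.eq_one_of_mul_eq_one_right h.symm
  -- A direct factor of a represented poset is a lower set of it, hence represented. Finiteness
  -- supplies a minimal `b`; a least element may not exist.
  have hfac {X Y : Type _} [PartialOrder X] [OrderTop X] [PartialOrder Y] (m)
      (e : X × Y ≃o T m) : ∃ n, Nonempty (T n ≃o X) := by
    have : Finite (X × Y) := Finite.of_equiv _ e.symm.toEquiv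
    have : Nonempty Y := ⟨(e.symm ⊤).2⟩
    have : Finite Y := Finite.prod_right X
    obtain ⟨b, hb⟩ := (Set.finite_univ (α := Y)).exists_minimal Set.univ_nonempty
    obtain ⟨n, ⟨g⟩⟩ := hIic m (e (⊤, b))
    exact ⟨n, ⟨g.trans ((e.iicCongr _).symm.trans (iicProdOfIsMin (fun y hy => hb.2 trivial hy)))⟩⟩
  have hprod {m x y : M} {X Y : Type _} [PartialOrder X] [PartialOrder Y] (ex : T x ≃o X)
      (ey : T y ≃o Y) (e : X × Y ≃o T m) : m = x * y := by
    obtain ⟨g⟩ := hmul x y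
    exact (hinj _ _ ⟨g.trans ((orderIsoProdCongr ex ey).trans e)⟩).symm
  have href : HasRefinement M := by
    intro a b c d h
    obtain ⟨e⟩ := hmul a b
    obtain ⟨e'⟩ := hmul c d
    rw [h] at e
    obtain ⟨g, h, k, ⟨ea⟩, ⟨eb⟩, ⟨ec⟩, ⟨ed⟩⟩ := (e.symm.trans e').exists_refinement
    obtain ⟨x, ⟨ex⟩⟩ := hfac a ea
    obtain ⟨y, ⟨ey⟩⟩ := hfac a (OrderIso.prodComm.trans ea)
    obtain ⟨z, ⟨ez⟩⟩ := hfac b eb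
    obtain ⟨w, ⟨ew⟩⟩ := hfac b (OrderIso.prodComm.trans eb)
    refine ⟨x, y, z, w, hprod ex ey ea, hprod ez ew eb, hprod ex ez ec, hprod ey ew ed⟩
  refine ⟨hunits, fun m => ?_⟩
  obtain ⟨s, hs, hm⟩ := exists_multiset_irreducible_prod_eq _ hpos hone hcard m
  exact ⟨s, ⟨hs, hm⟩, fun t ht => href.multiset_eq_of_prod_eq _ _ ht.1 hs (ht.2.trans hm.symm)⟩

/-! ### Polynomial rings as monoid algebras -/

/-- The monoid algebra of a free commutative monoid is a polynomial ring. -/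
theorem MonoidAlgebra.bijective_aeval_of {R σ M : Type*} [CommRing R] [CommMonoid M] (g : σ → M)
    (hg : Function.Bijective fun s : Multiset σ => (s.map g).prod) :
    Function.Bijective (MvPolynomial.aeval (R := R) (S₁ := MonoidAlgebra R M)
      fun i => MonoidAlgebra.of R M (g i)) := by
  classical
  -- Exponent vectors are multisets of variables, so `hg` matches monomials with elements of `M`. It
  -- remains to see that evaluation is the linear isomorphism `L` matching these two bases.
  let e : (σ →₀ ℕ) ≃ M := Multiset.toFinsupp.symm.toEquiv.trans (Equiv.ofBijective _ hg)
  let L := (MvPolynomial.basisMonomials σ R).equiv (MonoidAlgebra.basis M R) e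
  have h : (MvPolynomial.aeval (R := R) (S₁ := MonoidAlgebra R M)
      fun i => MonoidAlgebra.of R M (g i)).toLinearMap = L.toLinearMap := by
    refine (MvPolynomial.basisMonomials σ R).ext fun s => ?_
    have he : e s = s.prod fun i n => g i ^ n := by
      show ((Finsupp.toMultiset s).map g).prod = _
      rw [Finsupp.toMultiset_map, Finsupp.prod_toMultiset,
        Finsupp.prod_mapDomain_index (by simp) (by intros; exact pow_add _ _ _)]
    rw [LinearEquiv.coe_coe, Module.Basis.equiv_apply, AlgHom.toLinearMap_apply,
      MvPolynomial.coe_basisMonomials, MvPolynomial.aeval_monomial, map_one, one_mul, he]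
    simp only [← map_pow]
    rw [← map_finsuppProd]
    simp [MonoidAlgebra.basis, MonoidAlgebra.of_apply]
  have h' : ⇑(MvPolynomial.aeval (R := R) (S₁ := MonoidAlgebra R M)
      fun i => MonoidAlgebra.of R M (g i)) = L := funext fun x => LinearMap.congr_fun h x
  rw [h']
  exact L.bijective

/-! ### Unique factorization over a named set of irreducibles -/

/-- Unique factorization into elements of `M` that are named by the elements of `α` with the
property `p`. -/
theorem existsUnique_multiset_map {α M : Type*} [CommMonoid M] {p : α → Prop} {c : α → M}
    (hc : Function.Injective c) (hp : ∀ m, Irreducible m ↔ ∃ a, p a ∧ c a = m) {m : M}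
    (hm : ∃! s : Multiset M, (∀ q ∈ s, Irreducible q) ∧ s.prod = m) :
    ∃! s : Multiset α, (∀ a ∈ s, p a) ∧ (s.map c).prod = m := by
  obtain ⟨t, ⟨ht, rfl⟩, huniq⟩ := hm
  have hlift : ∀ q ∈ t, ∃ a, c a = q := fun q hq => ((hp q).1 (ht q hq)).imp fun _ h => h.2
  -- All members of `t` are in the range of `c`, so a list representing `t` lifts.
  obtain ⟨s, rfl⟩ : ∃ s : Multiset α, s.map c = t := by
    induction t using Quotient.inductionOn with
    | _ l =>
      obtain ⟨l', rfl⟩ : l ∈ Set.range (List.map c) := by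
        rw [Set.range_list_map]
        exact hlift
      exact ⟨l', rfl⟩
  refine ⟨s, ⟨fun a ha => ?_, rfl⟩, fun s' hs' => Multiset.map_injective hc (huniq _ ⟨?_, hs'.2⟩)⟩
  · obtain ⟨b, hb, hba⟩ := (hp _).1 (ht _ (Multiset.mem_map_of_mem c ha))
    rwa [← hc hba]
  · intro q hq
    obtain ⟨a, ha, rfl⟩ := Multiset.mem_map.1 hq
    exact (hp _).2 ⟨a, hs'.1 a ha, rfl⟩

theorem bijective_multiset_subtype_prod {α M : Type*} [CommMonoid M] {p : α → Prop} {c : α → M}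
    (h : ∀ m, ∃! s : Multiset α, (∀ a ∈ s, p a) ∧ (s.map c).prod = m) :
    Function.Bijective fun s : Multiset {a // p a} => (s.map fun a => c a.1).prod := by
  have hp (s : Multiset {a // p a}) : ∀ a ∈ s.map Subtype.val, p a := by
    intro a ha
    obtain ⟨b, -, rfl⟩ := Multiset.mem_map.1 ha
    exact b.2
  constructor
  · intro s t hst
    refine Multiset.map_injective Subtype.val_injective
      ((h (s.map fun a => c a.1).prod).unique ⟨hp s, ?_⟩ ⟨hp t, ?_⟩)
    · rw [Multiset.map_map]; rfl
    · rw [Multiset.map_map]; exact hst.symm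
  · intro m
    obtain ⟨s, ⟨hs, rfl⟩, -⟩ := h m
    lift s to Multiset {a // p a} using hs
    exact ⟨s, by simp [Multiset.map_map]⟩

/-! ### Faces of polytopes -/

namespace Polytope

/-- A nonempty face of a polytope is a polytope. -/
def face (P : Polytope) (F : Set (Fin P.ambient → ℝ)) (hF : IsExposed ℝ P.carrier F)
    (hne : F.Nonempty) : Polytope where
  ambient := P.ambient
  carrier := F
  nonempty := hne
  exists_finite := by
    obtain ⟨s, hs, h⟩ := P.exists_finite
    -- Extreme points of a face are extreme in `P`, hence among the generators; by Krein–Milman they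
    -- span the face.
    have hfin : (F.extremePoints ℝ).Finite := hs.subset <|
      hF.isExtreme.extremePoints_subset_extremePoints.trans <| by
        rw [h]; exact extremePoints_convexHull_subset
    refine ⟨_, hfin, ?_⟩
    have hclosed : IsClosed (convexHull ℝ (F.extremePoints ℝ)) := hfin.isClosed_convexHull ℝ
    rw [← hclosed.closure_eq]
    exact (closure_convexHull_extremePoints (hF.isCompact P.isCompact)
      (hF.convex P.convex)).symm

/-- By Krein–Milman a face is determined by its extreme points, which form a subset of the finite
generating set. -/
theorem finite_faceLattice (P : Polytope) : Finite P.FaceLattice := by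
  obtain ⟨s, hs, h⟩ := P.exists_finite
  have hsub (F : P.FaceLattice) : F.1.extremePoints ℝ ⊆ s :=
    F.2.isExtreme.extremePoints_subset_extremePoints.trans <| by
      rw [h]; exact extremePoints_convexHull_subset
  have : Finite (Set.powerset s) := hs.powerset
  refine Finite.of_injective (β := Set.powerset s)
    (fun F => ⟨F.1.extremePoints ℝ, hsub F⟩) fun F G hFG => Subtype.ext ?_
  have e : F.1.extremePoints ℝ = G.1.extremePoints ℝ := congrArg Subtype.val hFG
  rw [← closure_convexHull_extremePoints (F.2.isCompact P.isCompact) (F.2.convex P.convex), e,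
    closure_convexHull_extremePoints (G.2.isCompact P.isCompact) (G.2.convex P.convex)]

theorem finite_nonemptyFaces (P : Polytope) : Finite (NonemptyFaces P.carrier) := by
  have := P.finite_faceLattice
  exact Finite.of_injective (β := P.FaceLattice) (fun X => ⟨X.1, X.2.1⟩)
    fun X Y h => Subtype.ext (congrArg (fun Z : P.FaceLattice => Z.1) h)

/-- A face of a face of a polytope is a face of the polytope. -/
theorem isExposed_trans (P : Polytope) {F G : Set (Fin P.ambient → ℝ)}
    (hF : IsExposed ℝ P.carrier F) (hG : IsExposed ℝ F G) : IsExposed ℝ P.carrier G := by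
  obtain ⟨l, c, hl, hFe⟩ := isExposed_iff_affine.1 hF
  obtain ⟨k, d, hk, hGe⟩ := isExposed_iff_affine.1 hG
  obtain ⟨s, hs, hP⟩ := P.exists_finite
  have hsP : s ⊆ P.carrier := by rw [hP]; exact subset_convexHull ℝ s
  -- At a generator off `F` the negative term `l x + c` wins for large `N`; at one in `F` it
  -- vanishes and `k x + d ≤ 0` remains.
  have hN : ∃ N : ℝ, ∀ x ∈ s, N * (l x + c) + (k x + d) ≤ 0 := by
    have key (x) (hx : x ∈ s) :
        ∀ᶠ N : ℝ in Filter.atTop, N * (l x + c) + (k x + d) ≤ 0 := by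
      rcases (hl x (hsP hx)).lt_or_eq with h | h
      · filter_upwards [Filter.eventually_ge_atTop ((k x + d) / -(l x + c))] with N hN
        rw [div_le_iff₀ (by linarith)] at hN
        linarith
      · refine Filter.Eventually.of_forall fun N => ?_
        have := hk x (hFe ▸ ⟨hsP hx, h⟩)
        rw [h]
        linarith
    exact ((hs.eventually_all (l := Filter.atTop)).2 key).exists
  obtain ⟨N, hN⟩ := hN
  have hNP : ∀ x ∈ P.carrier, N * (l x + c) + (k x + d) ≤ 0 := by
    have hconv : Convex ℝ {x | (N • l + k) x ≤ -(N * c + d)} :=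
      convex_halfSpace_le (N • l + k).toLinearMap.isLinear _
    have hsub : s ⊆ {x | (N • l + k) x ≤ -(N * c + d)} := fun x hx => by
      have := hN x hx
      show N * l x + k x ≤ _
      linarith
    intro x hx
    rw [hP] at hx
    have : N * l x + k x ≤ -(N * c + d) := convexHull_min hsub hconv hx
    linarith
  -- The extra copy of `l + c` makes the functional a sum of two nonpositive terms, so its zeros
  -- satisfy `l x + c = 0` and lie in `F`.
  refine isExposed_iff_affine.2 ⟨(N + 1) • l + k, (N + 1) * c + d, fun x hx => ?_, ?_⟩
  · show (N + 1) * l x + k x + _ ≤ 0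
    linarith [hNP x hx, hl x hx]
  · rw [hGe]
    ext x
    constructor
    · rintro ⟨hx, hx0⟩
      rw [hFe] at hx
      refine ⟨hx.1, ?_⟩
      show (N + 1) * l x + k x + _ = 0
      linear_combination hx0 + (N + 1) * hx.2
    · rintro ⟨hx, hx0⟩
      replace hx0 : (N + 1) * l x + k x + ((N + 1) * c + d) = 0 := hx0
      have h0 : l x + c = 0 := by linarith [hNP x hx, hl x hx]
      exact ⟨hFe ▸ ⟨hx, h0⟩, by linear_combination hx0 - (N + 1) * h0⟩

/-- The faces of a face of a polytope. -/
def facesFace (P : Polytope) (F : P.FaceLattice) (hne : F.1.Nonempty) :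
    (P.face F.1 F.2 hne).FaceLattice ≃o Set.Iic F where
  toFun G := ⟨⟨G.1, P.isExposed_trans F.2 G.2⟩, G.2.subset⟩
  invFun G := ⟨G.1.1, G.1.2.mono F.2.subset G.2⟩
  left_inv _ := rfl
  right_inv _ := rfl
  map_rel_iff' := Iff.rfl

/-- The nonempty faces of a face of a polytope. -/
def nonemptyFacesFace (P : Polytope) (F : NonemptyFaces P.carrier) :
    NonemptyFaces (P.face F.1 F.2.1 F.2.2).carrier ≃o Set.Iic F where
  toFun G := ⟨⟨G.1, P.isExposed_trans F.2.1 G.2.1, G.2.2⟩, G.2.1.subset⟩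
  invFun G := ⟨G.1.1, G.1.2.1.mono F.2.1.subset G.2, G.1.2.2⟩
  left_inv _ := rfl
  right_inv _ := rfl
  map_rel_iff' := Iff.rfl

end Polytope

instance facesOrderTop {E : Type*} [TopologicalSpace E] [AddCommMonoid E] [Module ℝ E]
    (A : Set E) : OrderTop (Faces A) where
  top := ⟨A, IsExposed.refl A⟩
  le_top X := X.2.subset

/-! ### Unique factorization of combinatorial polytopes -/

/-- The class of a polytope. -/
def CombPolytope.mk (P : Polytope) : CombPolytope := Quotient.mk _ P

theorem CombPolytope.mk_eq_mk {P Q : Polytope} : mk P = mk Q ↔ P.CombEquiv Q :=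
  ⟨fun h => Quotient.exact h, fun h => Quotient.sound h⟩

/-- A polytope representing a class. -/
noncomputable def CombPolytope.out (X : CombPolytope) : Polytope := Quotient.out X

theorem CombPolytope.mk_out (X : CombPolytope) : mk X.out = X := Quotient.out_eq X

theorem CombPolytope.out_mk (P : Polytope) : (mk P).out.CombEquiv P := mk_eq_mk.1 (mk_out _)

/-- The class of a polytope. -/
def JoinCombPolytope.mk (P : Polytope) : JoinCombPolytope := Quotient.mk _ P

theorem JoinCombPolytope.mk_eq_mk {P Q : Polytope} : mk P = mk Q ↔ P.CombEquiv Q :=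
  ⟨fun h => Quotient.exact h, fun h => Quotient.sound h⟩

/-- A polytope representing a class. -/
noncomputable def JoinCombPolytope.out (X : JoinCombPolytope) : Polytope := Quotient.out X

theorem JoinCombPolytope.mk_out (X : JoinCombPolytope) : mk X.out = X := Quotient.out_eq X

theorem JoinCombPolytope.out_mk (P : Polytope) : (mk P).out.CombEquiv P := mk_eq_mk.1 (mk_out _)

/-! ### Factorization under direct product -/

theorem CombPolytope.mk_eq_one_iff (P : Polytope) :
    mk P = 1 ↔ P.dim = 0 := by
  rw [P.dim_eq_zero_iff]
  have hpt : Subsingleton (NonemptyFaces Polytope.point.carrier) :=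
    Polytope.subsingleton_nonemptyFaces Set.subsingleton_singleton
  constructor
  · intro h
    obtain ⟨e⟩ := Polytope.combEquiv_iff.1 (mk_eq_mk.1 h : P.CombEquiv Polytope.point)
    exact e.toEquiv.subsingleton
  · intro h
    let t (Q : Polytope) : NonemptyFaces Q.carrier := ⟨Q.carrier, IsExposed.refl _, Q.nonempty⟩
    exact mk_eq_mk.2 (Polytope.combEquiv_iff.2 ⟨⟨⟨fun _ => t _, fun _ => t _,
      fun _ => Subsingleton.elim _ _, fun _ => Subsingleton.elim _ _⟩,
      fun {x y} => ⟨fun _ => (Subsingleton.elim x y).le, fun _ => le_rfl⟩⟩⟩)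

/-- The posets are those of nonempty faces: a product with an empty face is empty, so full face
lattices would not multiply. -/
theorem CombPolytope.existsUnique_irreducible :
    Subsingleton CombPolytopeˣ ∧ ∀ X : CombPolytope,
      ∃! s : Multiset CombPolytope, (∀ Y ∈ s, Irreducible Y) ∧ s.prod = X := by
  let T (X : CombPolytope) : Type := NonemptyFaces X.out.carrier
  have iso (P : Polytope) :
      Nonempty (T (mk P) ≃o NonemptyFaces P.carrier) :=
    Polytope.combEquiv_iff.1 (out_mk P)
  let (X : CombPolytope) : OrderTop (T X) :=
    { top := ⟨_, IsExposed.refl _, X.out.nonempty⟩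
      le_top := fun F => F.2.1.subset }
  have (X : CombPolytope) : Finite (T X) := Polytope.finite_nonemptyFaces _
  refine existsUnique_multiset_of_posets T (fun X Y => ?_) (fun X Y h => ?_) fun X F => ?_
  · obtain ⟨e⟩ := iso (X.out.prod Y.out)
    have h : mk (X.out.prod Y.out) = X * Y :=
      congrArg₂ (fun X Y : CombPolytope => X * Y) X.mk_out Y.mk_out
    rw [h] at e
    exact ⟨e.trans (Polytope.nonemptyFacesProdIso _ _).symm⟩
  · rw [← X.mk_out, ← Y.mk_out]
    exact mk_eq_mk.2 (Polytope.combEquiv_iff.2 h)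
  · obtain ⟨e⟩ := iso (X.out.face F.1 F.2.1 F.2.2)
    exact ⟨_, ⟨e.trans (X.out.nonemptyFacesFace F)⟩⟩

/-- Only the point is a unit, so nonunits are exactly the classes of positive dimension. -/
theorem CombPolytope.irreducible_iff_isIndecomposable [Subsingleton CombPolytopeˣ]
    (X : CombPolytope) : Irreducible X ↔ X.IsIndecomposable := by
  obtain ⟨P, rfl⟩ : ∃ P, mk P = X := ⟨_, X.mk_out⟩
  · have hdim (Q : Polytope) : IsUnit (mk Q) ↔ ¬ 0 < Q.dim := by
      rw [isUnit_iff_eq_one, mk_eq_one_iff, Nat.pos_iff_ne_zero, not_not]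
    change _ ↔ 0 < P.dim ∧ ¬ ∃ P₁ P₂ : Polytope, 0 < P₁.dim ∧ 0 < P₂.dim ∧ P.CombEquiv (P₁.prod P₂)
    rw [irreducible_iff, hdim, not_not]
    refine and_congr_right fun _ => ⟨?_, ?_⟩
    · rintro h ⟨P₁, P₂, h₁, h₂, e⟩
      rcases h (a := mk P₁) (b := mk P₂) (mk_eq_mk.2 e) with h | h
      exacts [(hdim _).1 h h₁, (hdim _).1 h h₂]
    · intro h X Y e
      obtain ⟨P₁, rfl⟩ : ∃ P, mk P = X := ⟨_, X.mk_out⟩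
      obtain ⟨P₂, rfl⟩ : ∃ P, mk P = Y := ⟨_, Y.mk_out⟩
      by_contra hcon
      rw [not_or] at hcon
      exact h ⟨P₁, P₂, not_not.1 fun h' => hcon.1 ((hdim P₁).2 h'),
        not_not.1 fun h' => hcon.2 ((hdim P₂).2 h'), mk_eq_mk.1 e⟩

/-! ### Factorization under join -/

/-- The underlying set of a representative of a combinatorial polytope, and the empty set for the
formal unit. -/
noncomputable def JoinCombPolytope.rep (x : WithOne JoinCombPolytope) : Σ n, Set (Fin n → ℝ) :=
  WithOne.recOneCoe (motive := fun _ => Σ n, Set (Fin n → ℝ)) ⟨0, ∅⟩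
    (fun X => ⟨X.out.ambient, X.out.carrier⟩) x

theorem JoinCombPolytope.existsUnique_irreducible :
    Subsingleton (WithOne JoinCombPolytope)ˣ ∧ ∀ x : WithOne JoinCombPolytope,
      ∃! s : Multiset (WithOne JoinCombPolytope), (∀ y ∈ s, Irreducible y) ∧ s.prod = x := by
  let T (x : WithOne JoinCombPolytope) : Type := Faces (rep x).2
  have iso (P : Polytope) :
      Nonempty (T (mk P : JoinCombPolytope)
        ≃o P.FaceLattice) := out_mk P
  -- The empty face and the whole polytope differ, so no polytope is confused with the formal unit.
  have hbot (X : JoinCombPolytope) : ¬ Subsingleton (T X) := fun h =>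
    X.out.nonempty.ne_empty (congrArg Subtype.val (h.elim
      (⟨X.out.carrier, IsExposed.refl _⟩ : X.out.FaceLattice)
      ⟨∅, isExposed_empty⟩))
  have uniq : Subsingleton (T 1) :=
    ⟨fun F G => Subtype.ext ((Set.subset_empty_iff.1 F.2.subset).trans
      (Set.subset_empty_iff.1 G.2.subset).symm)⟩
  have (x : WithOne JoinCombPolytope) : Finite (T x) := by
    induction x using WithOne.recOneCoe with
    | one => exact Finite.of_subsingleton
    | coe X => exact Polytope.finite_faceLattice _
  have prodT1 (x : WithOne JoinCombPolytope) : Nonempty (T x ≃o T x × T 1) :=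
    ⟨⟨⟨fun F => (F, ⊤), Prod.fst, fun _ => rfl, fun _ => Prod.ext rfl (Subsingleton.elim _ _)⟩,
      ⟨fun h => h.1, fun h => ⟨h, le_rfl⟩⟩⟩⟩
  refine existsUnique_multiset_of_posets T (fun x y => ?_) (fun x y h => ?_) fun x F => ?_
  · induction x using WithOne.recOneCoe with
    | one =>
      obtain ⟨e⟩ := prodT1 y
      rw [one_mul]
      exact ⟨e.trans OrderIso.prodComm⟩
    | coe X =>
      induction y using WithOne.recOneCoe with
      | one =>
        rw [mul_one]
        exact prodT1 X
      | coe Y =>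
        obtain ⟨e⟩ := iso (X.out.join Y.out)
        have h : mk (X.out.join Y.out) = X * Y :=
          congrArg₂ (fun X Y : JoinCombPolytope => X * Y) X.mk_out Y.mk_out
        rw [h] at e
        rw [← WithOne.coe_mul]
        exact ⟨e.trans (Polytope.faceLatticeJoin _ _)⟩
  · obtain ⟨e⟩ := h
    induction x using WithOne.recOneCoe with
    | one =>
      induction y using WithOne.recOneCoe with
      | one => rfl
      | coe Y => exact absurd e.symm.toEquiv.subsingleton (hbot Y)
    | coe X =>
      induction y using WithOne.recOneCoe with
      | one => exact absurd e.toEquiv.subsingleton (hbot X)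
      | coe Y =>
        rw [← X.mk_out, ← Y.mk_out]
        exact congrArg _ (mk_eq_mk.2 ⟨e⟩)
  -- The lower set of the empty face is one point and comes from no polytope; the formal unit
  -- represents it.
  · rcases F.1.eq_empty_or_nonempty with hF | hF
    · refine ⟨1, ⟨⟨⟨fun _ => ⟨F, Set.self_mem_Iic⟩, fun _ => ⊤, fun _ => Subsingleton.elim _ _, ?_⟩, ?_⟩⟩⟩
      · rintro ⟨G, hG⟩
        refine Subtype.ext (Subtype.ext ?_)
        exact hF.trans (Set.subset_empty_iff.1 (hF ▸ hG : G.1 ⊆ ∅)).symm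
      · intro G H
        exact ⟨fun _ => (Subsingleton.elim G H).le, fun _ => le_rfl⟩
    · induction x using WithOne.recOneCoe with
      | one => exact absurd (Set.subset_empty_iff.1 F.2.subset) hF.ne_empty
      | coe X =>
        obtain ⟨e⟩ := iso (X.out.face F.1 F.2 hF)
        exact ⟨_, ⟨e.trans (X.out.facesFace F hF)⟩⟩

/-- The only unit is the adjoined one, so a factorization into nonunits is a join of two actual
polytopes. -/
theorem JoinCombPolytope.irreducible_iff_isIndecomposable
    [Subsingleton (WithOne JoinCombPolytope)ˣ] (x : WithOne JoinCombPolytope) :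
    Irreducible x ↔ ∃ X : JoinCombPolytope, X.IsIndecomposable ∧ (X : WithOne JoinCombPolytope) = x := by
  induction x using WithOne.recOneCoe with
  | one => exact ⟨fun h => absurd isUnit_one h.not_isUnit, fun ⟨X, _, h⟩ => absurd h WithOne.coe_ne_one⟩
  | coe X =>
    trans X.IsIndecomposable
    swap
    · exact ⟨fun h => ⟨X, h, rfl⟩, fun ⟨Y, hY, e⟩ => WithOne.coe_inj.1 e ▸ hY⟩
    obtain ⟨P, rfl⟩ : ∃ P, mk P = X := ⟨_, X.mk_out⟩
    · change _ ↔ ¬ ∃ P₁ P₂ : Polytope, P.CombEquiv (P₁.join P₂)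
      simp only [irreducible_iff, isUnit_iff_eq_one]
      constructor
      · rintro ⟨-, h⟩ ⟨P₁, P₂, e⟩
        rcases h (a := (mk P₁ : JoinCombPolytope))
          (b := (mk P₂ : JoinCombPolytope))
          (congrArg (WithOne.coe (α := JoinCombPolytope)) (mk_eq_mk.2 e)) with h | h
        exacts [WithOne.coe_ne_one h, WithOne.coe_ne_one h]
      · intro h
        refine ⟨WithOne.coe_ne_one, fun a b hab => ?_⟩
        induction a using WithOne.recOneCoe with
        | one => exact Or.inl rfl
        | coe Y =>
          induction b using WithOne.recOneCoe with
          | one => exact Or.inr rfl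
          | coe Z =>
            rw [← WithOne.coe_mul, WithOne.coe_inj] at hab
            rw [← Y.mk_out, ← Z.mk_out] at hab
            exact absurd ⟨_, _, mk_eq_mk.1 hab⟩ h

theorem mainTheorem10 :
    (∀ X : CombPolytope, ∃! s : Multiset CombPolytope,
      (∀ Y ∈ s, Y.IsIndecomposable) ∧ s.prod = X) ∧
    (∀ X : JoinCombPolytope, ∃! s : Multiset JoinCombPolytope,
      (∀ Y ∈ s, Y.IsIndecomposable) ∧
        (Multiset.map (WithOne.coe : JoinCombPolytope → WithOne JoinCombPolytope) s).prod = (X : WithOne JoinCombPolytope)) ∧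
    Function.Bijective (MvPolynomial.aeval (R := ℤ) (S₁ := PolytopeRing)
      fun X : {X : CombPolytope // X.IsIndecomposable} =>
        MonoidAlgebra.of ℤ CombPolytope X.1) ∧
    Function.Bijective (MvPolynomial.aeval (R := ℤ) (S₁ := JoinPolytopeRing)
      fun X : {X : JoinCombPolytope // X.IsIndecomposable} =>
        MonoidAlgebra.of ℤ (WithOne JoinCombPolytope) (X.1 : WithOne JoinCombPolytope)) := by
  obtain ⟨_, hC⟩ := CombPolytope.existsUnique_irreducible
  obtain ⟨_, hJ⟩ := JoinCombPolytope.existsUnique_irreducible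
  have h₁ (X : CombPolytope) := existsUnique_multiset_map (p := CombPolytope.IsIndecomposable)
    Function.injective_id (fun m => by simp [CombPolytope.irreducible_iff_isIndecomposable]) (hC X)
  -- Stated for the formal unit too: the polynomial ring needs the whole monoid to be free, while
  -- the second claim uses only polytopes.
  have h₂ (x : WithOne JoinCombPolytope) := existsUnique_multiset_map
    (c := (WithOne.coe : JoinCombPolytope → WithOne JoinCombPolytope)) WithOne.coe_injective
    JoinCombPolytope.irreducible_iff_isIndecomposable (hJ x)
  exact ⟨fun X => by simpa using h₁ X, fun X => h₂ X,
    MonoidAlgebra.bijective_aeval_of _ (bijective_multiset_subtype_prod h₁),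
    MonoidAlgebra.bijective_aeval_of _ (bijective_multiset_subtype_prod h₂)⟩
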